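/- Let $(\Omega,\mathcal F,\mathbb P)$ be a probability space and $L^1=L^1(\Omega,\mathcal F,\mathbb P)$ the space of (classes of) integrable real random variables. Use the conventions $\infty-\infty=-\infty$, $\infty\cdot 0=0$ and $\inf\emptyset=\infty$. For $X\in L^1$ put $$\mathrm{VaR}_p(X)=\inf\{y\in\mathbb R\mid \mathbb P(X\le y)\ge p\}\ (0<p\le 1),\qquad \mathrm{VaR}_0(X)=\operatorname{ess\,inf}X,$$ $$\mathrm{ES}_p(X)=\frac1{1-p}\int_p^1\mathrm{VaR}_q(X)\,dq\ (0\le p<1),\qquad \mathrm{ES}_1(X)=\operatorname{ess\,sup}X,$$ $$\mathrm{RVaR}_{\alpha_1,\alpha_2}(X)=\frac1{\alpha_2-\alpha_1}\int_{\alpha_1}^{\alpha_2}\mathrm{VaR}_u(X)\,du\ (0\le\alpha_1<\alpha_2\le1),\qquad \mathrm{RVaR}_{\alpha,\alpha}(X)=\mathrm{VaR}_\alpha(X).$$ For $q\in(0,1)$ let the expectile $e_q(X)$ be the unique real solution $x$ of $q\,E[\max\{X-x,0\}]=(1-q)\,E[-\min\{X-x,0\}]$, and put $e_0(X)=\operatorname{ess\,inf}X$,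 $e_1(X)=\operatorname{ess\,sup}X$. For a function $g:[0,1]\to(-\infty,\infty]$ and a family $\mathcal P=(\rho_p)_{p\in[0,1]}$ of maps $\rho_p:L^1\to[-\infty,\infty]$ let $$\rho_{\mathcal P,g}(X)=\sup_{p\in[0,1]}\{\rho_p(X)-g(p)\}.$$ Fix levels $0=p_0<p_1<\dots<p_n<p_{n+1}=1$ with $n\ge1$, and $r\in(0,1)$. The simplified composed risk measure (SCRM), the composed risk measure (CRM), the fixed composed risk measure (FCRM) and the adjusted expectile risk measure (AERM) are the maps $\rho_{\mathcal P,g}$ for the families - SCRM: $\rho_p(X)=\mathrm{VaR}_p(X)\mathbf 1_{[0,r]}(p)+\mathrm{ES}_p(X)\mathbf 1_{(r,1]}(p)$; - CRM: $\rho_p(X)=\mathrm{RVaR}_{p,p_1}(X)\mathbf 1_{[0,p_1]}(p)+\sum_{i=2}^n\mathrm{RVaR}_{p,p_i}(X)\mathbf 1_{(p_{i-1},p_i]}(p)+\mathrm{ES}_p(X)\mathbf 1_{(p_n,1]}(p)$; - FCRM: $\rho_p(X)=\mathrm{RVaR}_{0,p_1}(X)\mathbf 1_{[0,p_1]}(p)+\sum_{i=2}^n\mathrm{RVaR}_{p_{i-1},p_i}(X)\mathbf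 1_{(p_{i-1},p_i]}(p)+\mathrm{ES}_p(X)\mathbf 1_{(p_n,1]}(p)$; - AERM: $\rho_p(X)=e_p(X)$. Assume that $g:[0,1]\to(-\infty,\infty]$ is increasing (not necessarily strictly), lower semicontinuous, with $g(0)=0$ and $g(p)<\infty$ for some $p\in(0,1]$, that the maxima $a=\max\{p\in[0,1]\mid g(p)=0\}$ and $b=\max\{p\in[0,1]\mid g(p)<\infty\}$ exist, and that $0<a<b<1$. Then for every $r\in(0,1)$ the SCRM, for all levels as above the CRM and the FCRM, and the AERM are finite-valued on $L^1$. In addition, the FCRM (for all levels as above) and the AERM are continuous with respect to the $L^1$-norm. -/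

import Mathlib

open MeasureTheory
open scoped ENNReal

noncomputable section

namespace AdjRisk

/-- The class `𝒢` of target risk profiles: increasing functions `g : [0,1] → (-∞,∞]`
with `g p < ∞` for at least one `p ∈ (0,1]`. -/
structure IsTargetProfile (g : unitInterval → EReal) : Prop where
  monotone : Monotone g
  ne_bot : ∀ p, g p ≠ ⊥
  exists_lt_top : ∃ p, 0 < p ∧ g p < ⊤

/-- The class `𝒢₀` of target risk profiles with `g 0 = 0`. -/
structure IsTargetProfileZero (g : unitInterval → EReal) : Prop extends IsTargetProfile g where
  zero : g 0 = 0

/-- The assumption on `g ∈ 𝒢₀`: lower semicontinuity, and `0 < p₁ < p₂ < 1` for the maxima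
`p₁ = max {p | g p = 0}` and `p₂ = max {p | g p < ∞}` (which are required to exist). -/
structure FinitenessAssumption (g : unitInterval → EReal) : Prop extends
    IsTargetProfileZero g where
  lowerSemicontinuous : LowerSemicontinuous g
  levels : ∃ p₁ p₂ : unitInterval, IsGreatest {p | g p = 0} p₁ ∧ IsGreatest {p | g p < ⊤} p₂ ∧
    0 < p₁ ∧ p₁ < p₂ ∧ p₂ < 1

/-- The integral over `(α, β]` of an extended real function, as the integral of its positive part
minus the integral of its negative part. -/
def extIntegral (f : ℝ → EReal) (α β : ℝ) : EReal :=
  ((∫⁻ u in Set.Ioc α β, (f u).toENNReal : ℝ≥0∞) : EReal) -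
    ((∫⁻ u in Set.Ioc α β, (-f u).toENNReal : ℝ≥0∞) : EReal)

variable {Ω : Type*} [MeasurableSpace Ω]

/-- Value-at-Risk at level `p ∈ [0,1]`: the lower quantile
`inf {y ∈ ℝ | P(Y ≤ y) ≥ p}` for `p ∈ (0,1]` (with `inf ∅ = ∞`), and `ess inf Y` for `p = 0`. -/
def VaR (P : Measure Ω) (p : ℝ) (Y : Ω → ℝ) : EReal :=
  if p = 0 then essInf (fun ω => (Y ω : EReal)) P
  else ⨅ y ∈ {y : ℝ | p ≤ P.real {ω | Y ω ≤ y}}, (y : EReal)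

/-- Expected Shortfall at level `p ∈ [0,1]`. -/
def ES (P : Measure Ω) (p : ℝ) (X : Ω → ℝ) : EReal :=
  if p < 1 then ((1 / (1 - p) : ℝ) : EReal) * extIntegral (fun q => VaR P q X) p 1
  else essSup (fun ω => (X ω : EReal)) P

/-- Range-Value-at-Risk at levels `0 ≤ α₁ ≤ α₂ ≤ 1`, equal to `VaR` when the levels coincide. -/
def RVaR (P : Measure Ω) (α₁ α₂ : ℝ) (X : Ω → ℝ) : EReal :=
  if α₁ < α₂ then ((1 / (α₂ - α₁) : ℝ) : EReal) * extIntegral (fun u => VaR P u X) α₁ α₂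
  else VaR P α₁ X

/-- `x` solves the equation that defines the expectile of `X` at level `q ∈ (0,1)`. -/
def IsExpectile (P : Measure Ω) (q : ℝ) (X : Ω → ℝ) (x : ℝ) : Prop :=
  q * ∫ ω, max (X ω - x) 0 ∂P = (1 - q) * ∫ ω, -min (X ω - x) 0 ∂P

open Classical in
/-- The expectile at level `q ∈ [0,1]`: the unique solution of the defining equation for
`q ∈ (0,1)` (the value is `∞` if there were no unique solution, so that finiteness is never
automatic), the essential infimum for `q = 0` and the essential supremum for `q = 1`. -/
def expectile (P : Measure Ω) (q : ℝ) (X : Ω → ℝ) : EReal :=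
  if q = 0 then essInf (fun ω => (X ω : EReal)) P
  else if q = 1 then essSup (fun ω => (X ω : EReal)) P
  else if h : ∃! x : ℝ, IsExpectile P q X x then (h.exists.choose : EReal) else ⊤

/-- The map `ρ_{𝒫,g}(X) = sup_{p ∈ [0,1]} (ρ_p(X) - g(p))` on `L¹` for a family
`𝒫 = (ρ_p)_{p ∈ [0,1]}`. In `EReal` one has `⊤ - ⊤ = ⊥`, the convention `∞ - ∞ = -∞`. -/
def adjusted (P : Measure Ω) (ρ : ℝ → (Ω → ℝ) → EReal) (g : unitInterval → EReal)
    (X : Lp ℝ 1 P) : EReal :=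
  ⨆ p : unitInterval, (ρ (p : ℝ) X - g p)

/-- The family of the simplified composed risk measure: `VaR_p` on `[0,r]`, `ES_p` on `(r,1]`. -/
def familySC (P : Measure Ω) (r p : ℝ) (X : Ω → ℝ) : EReal :=
  (Set.Icc 0 r).indicator (fun p => VaR P p X) p + (Set.Ioc r 1).indicator (fun p => ES P p X) p

/-- `l 0, …, l (n+1)` are levels `0 = p₀ < p₁ < ⋯ < pₙ < pₙ₊₁ = 1` with `n ≥ 1`. -/
structure IsLevels (n : ℕ) (l : ℕ → ℝ) : Prop where
  one_le : 1 ≤ n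
  zero : l 0 = 0
  last : l (n + 1) = 1
  lt_succ : ∀ k ≤ n, l k < l (k + 1)

/-- The family of the composed risk measure. -/
def familyC (P : Measure Ω) (n : ℕ) (l : ℕ → ℝ) (p : ℝ) (X : Ω → ℝ) : EReal :=
  (Set.Icc 0 (l 1)).indicator (fun p => RVaR P p (l 1) X) p +
    (∑ i ∈ Finset.Icc 2 n, (Set.Ioc (l (i - 1)) (l i)).indicator (fun p => RVaR P p (l i) X) p) +
    (Set.Ioc (l n) 1).indicator (fun p => ES P p X) p

/-- The family of the fixed composed risk measure. -/
def familyFC (P : Measure Ω) (n : ℕ) (l : ℕ → ℝ) (p : ℝ) (X : Ω → ℝ) : EReal :=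
  (Set.Icc 0 (l 1)).indicator (fun _ => RVaR P 0 (l 1) X) p +
    (∑ i ∈ Finset.Icc 2 n,
      (Set.Ioc (l (i - 1)) (l i)).indicator (fun _ => RVaR P (l (i - 1)) (l i) X) p) +
    (Set.Ioc (l n) 1).indicator (fun p => ES P p X) p

/-- Simplified composed risk measure. -/
def SCRM (P : Measure Ω) (r : ℝ) (g : unitInterval → EReal) : Lp ℝ 1 P → EReal :=
  adjusted P (familySC P r) g

/-- Composed risk measure. -/
def CRM (P : Measure Ω) (n : ℕ) (l : ℕ → ℝ) (g : unitInterval → EReal) : Lp ℝ 1 P → EReal :=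
  adjusted P (familyC P n l) g

/-- Fixed composed risk measure. -/
def FCRM (P : Measure Ω) (n : ℕ) (l : ℕ → ℝ) (g : unitInterval → EReal) : Lp ℝ 1 P → EReal :=
  adjusted P (familyFC P n l) g

/-- Adjusted expectile risk measure. -/
def AERM (P : Measure Ω) (g : unitInterval → EReal) : Lp ℝ 1 P → EReal :=
  adjusted P (expectile P) g

/-- A map on `L¹` with extended real values takes only finite values. -/
def FiniteValued {P : Measure Ω} (ρ : Lp ℝ 1 P → EReal) : Prop :=
  ∀ X, ρ X ≠ ⊥ ∧ ρ X ≠ ⊤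

end AdjRisk

end

namespace AdjRisk

variable {Ω : Type*} [MeasurableSpace Ω] {P : Measure Ω} {X Y : Ω → ℝ}

/-- The real-valued lower quantile of `X` at level `u`, meaningful for `u ∈ (0,1)`. -/
noncomputable def quantile (P : Measure Ω) (X : Ω → ℝ) (u : ℝ) : ℝ :=
  sInf {y | u ≤ P.real {ω | X ω ≤ y}}

section Quantile

variable [IsProbabilityMeasure P]

theorem cdf_map_eq (hX : Measurable X) (y : ℝ) :
    ProbabilityTheory.cdf (P.map X) y = P.real {ω | X ω ≤ y} := by
  have := Measure.isProbabilityMeasure_map (μ := P) hX.aemeasurable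
  rw [ProbabilityTheory.cdf_eq_real, map_measureReal_apply hX measurableSet_Iic]
  rfl

theorem monotone_measureReal_le (X : Ω → ℝ) : Monotone fun y => P.real {ω | X ω ≤ y} :=
  fun _ _ h => measureReal_mono fun _ hω => le_trans hω h

theorem exists_le_measureReal_le (hX : Measurable X) {u : ℝ} (hu : u < 1) :
    ∃ y, u ≤ P.real {ω | X ω ≤ y} := by
  obtain ⟨y, hy⟩ := ((ProbabilityTheory.tendsto_cdf_atTop (P.map X)).eventually
    (eventually_gt_nhds hu)).exists
  rw [cdf_map_eq hX y] at hy
  exact ⟨y, hy.le⟩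

theorem bddBelow_le_measureReal_le (hX : Measurable X) {u : ℝ} (hu : 0 < u) :
    BddBelow {y | u ≤ P.real {ω | X ω ≤ y}} := by
  obtain ⟨y, hy⟩ := ((ProbabilityTheory.tendsto_cdf_atBot (P.map X)).eventually
    (eventually_lt_nhds hu)).exists
  rw [cdf_map_eq hX y] at hy
  refine ⟨y, fun z hz => le_of_not_gt fun hzy => ?_⟩
  exact absurd (hz.trans (monotone_measureReal_le X hzy.le)) hy.not_ge

theorem le_measureReal_le_quantile (hX : Measurable X) {u : ℝ} (hu1 : u < 1) :
    u ≤ P.real {ω | X ω ≤ quantile P X u} := by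
  have hcont := (ProbabilityTheory.cdf (P.map X)).right_continuous (quantile P X u)
  have hcont' := hcont.mono Set.Ioi_subset_Ici_self
  have h : ∀ᶠ y in nhdsWithin (quantile P X u) (Set.Ioi (quantile P X u)),
      u ≤ ProbabilityTheory.cdf (P.map X) y := by
    filter_upwards [self_mem_nhdsWithin] with y hy
    obtain ⟨z, hz, hzy⟩ := exists_lt_of_csInf_lt (exists_le_measureReal_le (P := P) hX hu1) hy
    rw [cdf_map_eq hX]
    exact le_trans hz (monotone_measureReal_le X hzy.le)
  rw [← cdf_map_eq hX]
  exact ge_of_tendsto hcont' h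

theorem quantile_le_iff (hX : Measurable X) {u : ℝ} (hu0 : 0 < u) (hu1 : u < 1) (y : ℝ) :
    quantile P X u ≤ y ↔ u ≤ P.real {ω | X ω ≤ y} :=
  ⟨fun h => (le_measureReal_le_quantile hX hu1).trans (monotone_measureReal_le X h),
    fun h => csInf_le (bddBelow_le_measureReal_le hX hu0) h⟩

theorem quantile_mono_level (hX : Measurable X) {u v : ℝ} (hu : 0 < u) (hv : v < 1) (huv : u ≤ v) :
    quantile P X u ≤ quantile P X v :=
  (quantile_le_iff hX hu (huv.trans_lt hv) _).2
    (huv.trans (le_measureReal_le_quantile hX hv))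

theorem quantile_mono (hX : Measurable X) (hY : Measurable Y) (hXY : X ≤ Y) {u : ℝ} (hu0 : 0 < u)
    (hu1 : u < 1) : quantile P X u ≤ quantile P Y u :=
  (quantile_le_iff hX hu0 hu1 _).2 ((le_measureReal_le_quantile hY hu1).trans
    (measureReal_mono fun ω hω => (hXY ω).trans hω))

theorem aemeasurable_quantile (hX : Measurable X) :
    AEMeasurable (quantile P X) (volume.restrict (Set.Ioo 0 1)) :=
  aemeasurable_restrict_of_monotoneOn measurableSet_Ioo
    fun _ hu _ hv huv => quantile_mono_level hX hu.1 hv.2 huv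

theorem volume_Ioo_inter_Iic {c : ℝ} (h1 : c ≤ 1) :
    volume (Set.Ioo 0 1 ∩ Set.Iic c) = ENNReal.ofReal c := by
  apply le_antisymm
  · calc _ ≤ volume (Set.Ioc 0 c) := measure_mono fun x hx => ⟨hx.1.1, hx.2⟩
      _ = _ := by simp
  · calc ENNReal.ofReal c = volume (Set.Ioo 0 c) := by simp
      _ ≤ volume (Set.Ioo 0 1 ∩ Set.Iic c) := measure_mono fun x (hx : 0 < x ∧ x < c) =>
        ⟨⟨hx.1, hx.2.trans_le h1⟩, hx.2.le⟩

theorem map_quantile (hX : Measurable X) :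
    (volume.restrict (Set.Ioo (0 : ℝ) 1)).map (quantile P X) = P.map X := by
  have : IsFiniteMeasure ((volume.restrict (Set.Ioo (0 : ℝ) 1)).map (quantile P X)) :=
    Measure.isFiniteMeasure_map _ _
  refine Measure.ext_of_Iic _ _ fun y => ?_
  rw [Measure.map_apply_of_aemeasurable (aemeasurable_quantile hX) measurableSet_Iic,
    Measure.map_apply hX measurableSet_Iic, Measure.restrict_apply' measurableSet_Ioo]
  have h : quantile P X ⁻¹' Set.Iic y ∩ Set.Ioo 0 1 =
      Set.Ioo 0 1 ∩ Set.Iic (P.real {ω | X ω ≤ y}) := by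
    ext u
    simp only [Set.mem_inter_iff, Set.mem_preimage, Set.mem_Iic]
    constructor
    · rintro ⟨h, hu⟩
      exact ⟨hu, (quantile_le_iff hX hu.1 hu.2 y).1 h⟩
    · rintro ⟨hu, h⟩
      exact ⟨(quantile_le_iff hX hu.1 hu.2 y).2 h, hu⟩
  rw [h, volume_Ioo_inter_Iic measureReal_le_one, ofReal_measureReal]
  rfl

theorem integrableOn_quantile (hX : Measurable X) (hi : Integrable X P) :
    IntegrableOn (quantile P X) (Set.Ioo 0 1) := by
  have h : Integrable id (P.map X) := (integrable_map_measure aestronglyMeasurable_id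
    hX.aemeasurable).2 hi
  rw [← map_quantile hX] at h
  exact (integrable_map_measure aestronglyMeasurable_id (aemeasurable_quantile hX)).1 h

theorem integral_quantile (hX : Measurable X) :
    ∫ u in Set.Ioo 0 1, quantile P X u = ∫ ω, X ω ∂P := by
  have h1 := integral_map (aemeasurable_quantile (P := P) hX)
    (aestronglyMeasurable_id (α := ℝ))
  have h2 := integral_map (μ := P) hX.aemeasurable (aestronglyMeasurable_id (α := ℝ))
  rw [map_quantile hX, h2] at h1
  exact h1.symm

/-- The quantile map is a contraction for the `L¹`-norms. -/
theorem integral_abs_quantile_sub_le (hX : Measurable X) (hY : Measurable Y)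
    (hiX : Integrable X P) (hiY : Integrable Y P) :
    ∫ u in Set.Ioo 0 1, |quantile P X u - quantile P Y u| ≤ ∫ ω, |X ω - Y ω| ∂P := by
  have hiM := integrableOn_quantile (hX.sup hY) (hiX.sup hiY)
  have him := integrableOn_quantile (hX.inf hY) (hiX.inf hiY)
  calc _ ≤ ∫ u in Set.Ioo 0 1, (quantile P (X ⊔ Y) u - quantile P (X ⊓ Y) u) := by
        refine setIntegral_mono_on
          ((integrableOn_quantile hX hiX).sub (integrableOn_quantile hY hiY)).abs
          (hiM.sub him) measurableSet_Ioo fun u hu => ?_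
        have h1 := quantile_mono (P := P) hX (hX.sup hY) le_sup_left hu.1 hu.2
        have h2 := quantile_mono (P := P) hY (hX.sup hY) le_sup_right hu.1 hu.2
        have h3 := quantile_mono (P := P) (hX.inf hY) hX inf_le_left hu.1 hu.2
        have h4 := quantile_mono (P := P) (hX.inf hY) hY inf_le_right hu.1 hu.2
        rw [abs_le]
        constructor <;> linarith
    _ = ∫ ω, |X ω - Y ω| ∂P := by
        rw [integral_sub hiM him, integral_quantile (hX.sup hY), integral_quantile (hX.inf hY),
          ← integral_sub (hiX.sup hiY) (hiX.inf hiY)]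
        exact integral_congr_ae (.of_forall fun ω => max_sub_min_eq_abs' _ _)

theorem VaR_eq_quantile (hX : Measurable X) {u : ℝ} (hu0 : 0 < u) (hu1 : u < 1) :
    VaR P u X = (quantile P X u : EReal) := by
  rw [VaR, if_neg hu0.ne']
  refine le_antisymm (iInf₂_le (quantile P X u) (le_measureReal_le_quantile hX hu1)) (le_iInf₂ fun y hy => ?_)
  exact EReal.coe_le_coe_iff.2 ((quantile_le_iff hX hu0 hu1 y).2 hy)

theorem essInf_le_quantile (hX : Measurable X) {u : ℝ} (hu0 : 0 < u) (hu1 : u < 1) :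
    essInf (fun ω => (X ω : EReal)) P ≤ (quantile P X u : EReal) := by
  by_contra! h
  have h0 : P.real {ω | X ω ≤ quantile P X u} = 0 := by
    rw [measureReal_eq_zero_iff]
    have := ae_lt_of_lt_essInf h
    simpa [ae_iff] using this
  exact absurd (le_measureReal_le_quantile (P := P) hX hu1) (by rw [h0]; exact hu0.not_ge)

/-- The integral of the quantile function over `(α, β]`. -/
noncomputable def quantileIntegral (P : Measure Ω) (α β : ℝ) (X : Ω → ℝ) : ℝ :=
  ∫ u in Set.Ioo α β, quantile P X u

theorem extIntegral_VaR (hX : Measurable X) (hi : Integrable X P) {α β : ℝ} (hα : 0 ≤ α)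
    (hβ : β ≤ 1) :
    extIntegral (fun u => VaR P u X) α β = (quantileIntegral P α β X : EReal) := by
  have hint : IntegrableOn (quantile P X) (Set.Ioo α β) :=
    (integrableOn_quantile hX hi).mono_set (Set.Ioo_subset_Ioo hα hβ)
  have key : ∀ f : EReal → ℝ≥0∞, ∫⁻ u in Set.Ioc α β, f (VaR P u X) =
      ∫⁻ u in Set.Ioo α β, f (quantile P X u : EReal) := fun f => by
    rw [setLIntegral_congr Ioo_ae_eq_Ioc.symm]
    refine setLIntegral_congr_fun measurableSet_Ioo fun u hu => ?_
    simp only [VaR_eq_quantile hX (hα.trans_lt hu.1) (hu.2.trans_le hβ)]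
  have hneg := hint.neg
  rw [extIntegral, key EReal.toENNReal, key fun x => (-x).toENNReal, quantileIntegral,
    integral_eq_lintegral_pos_part_sub_lintegral_neg_part hint, EReal.coe_sub,
    EReal.coe_ennreal_toReal hint.lintegral_lt_top.ne, EReal.coe_ennreal_toReal]
  · rfl
  · exact hneg.lintegral_lt_top.ne

theorem abs_quantileIntegral_sub_le (hX : Measurable X) (hY : Measurable Y) (hiX : Integrable X P)
    (hiY : Integrable Y P) {α β : ℝ} (hα : 0 ≤ α) (hβ : β ≤ 1) :
    |quantileIntegral P α β X - quantileIntegral P α β Y| ≤ ∫ ω, |X ω - Y ω| ∂P := by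
  have hs : Set.Ioo α β ⊆ Set.Ioo 0 1 := Set.Ioo_subset_Ioo hα hβ
  have hdX := integrableOn_quantile hX hiX
  have hdY := integrableOn_quantile hY hiY
  rw [quantileIntegral, quantileIntegral, ← integral_sub (hdX.mono_set hs) (hdY.mono_set hs)]
  calc _ ≤ ∫ u in Set.Ioo α β, |quantile P X u - quantile P Y u| := abs_integral_le_integral_abs
    _ ≤ ∫ u in Set.Ioo 0 1, |quantile P X u - quantile P Y u| :=
        setIntegral_mono_set (hdX.sub hdY).abs (.of_forall fun _ => abs_nonneg _)
          hs.eventuallyLE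
    _ ≤ _ := integral_abs_quantile_sub_le hX hY hiX hiY

theorem abs_quantileIntegral_le (hX : Measurable X) (hi : Integrable X P) {α β : ℝ} (hα : 0 ≤ α)
    (hβ : β ≤ 1) : |quantileIntegral P α β X| ≤ ∫ ω, |X ω| ∂P := by
  have hs : Set.Ioo α β ⊆ Set.Ioo 0 1 := Set.Ioo_subset_Ioo hα hβ
  have hd := integrableOn_quantile hX hi
  calc _ ≤ ∫ u in Set.Ioo α β, |quantile P X u| := abs_integral_le_integral_abs
    _ ≤ ∫ u in Set.Ioo 0 1, |quantile P X u| :=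
        setIntegral_mono_set hd.abs (.of_forall fun _ => abs_nonneg _) hs.eventuallyLE
    _ = ∫ ω, |X ω| ∂P := by
        have h1 := integral_map (aemeasurable_quantile (P := P) hX)
          (continuous_abs.aestronglyMeasurable)
        have h2 := integral_map (μ := P) hX.aemeasurable continuous_abs.aestronglyMeasurable
        rw [map_quantile hX, h2] at h1
        exact h1.symm

theorem quantileIntegral_le (hX : Measurable X) (hi : Integrable X P) {α β : ℝ} (hα : 0 ≤ α)
    (hαβ : α ≤ β) (hβ : β < 1) : quantileIntegral P α β X ≤ (β - α) * quantile P X β := by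
  calc _ ≤ ∫ u in Set.Ioo α β, quantile P X β :=
        setIntegral_mono_on ((integrableOn_quantile hX hi).mono_set
          (Set.Ioo_subset_Ioo hα hβ.le)) (by simp) measurableSet_Ioo
          fun u hu => quantile_mono_level hX (hα.trans_lt hu.1) hβ hu.2.le
    _ = _ := by simp [hαβ]

theorem RVaR_eq (hX : Measurable X) (hi : Integrable X P) {α β : ℝ} (hα : 0 ≤ α) (hαβ : α < β)
    (hβ : β ≤ 1) : RVaR P α β X = ((1 / (β - α) * quantileIntegral P α β X : ℝ) : EReal) := by
  rw [RVaR, if_pos hαβ, extIntegral_VaR hX hi hα hβ, EReal.coe_mul]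

theorem ES_eq (hX : Measurable X) (hi : Integrable X P) {p : ℝ} (hp0 : 0 ≤ p) (hp1 : p < 1) :
    ES P p X = ((1 / (1 - p) * quantileIntegral P p 1 X : ℝ) : EReal) := by
  rw [ES, if_pos hp1, extIntegral_VaR hX hi hp0 le_rfl, EReal.coe_mul]

end Quantile

end AdjRisk

namespace AdjRisk

variable {Ω : Type*} [MeasurableSpace Ω] {P : Measure Ω} {X Y : Ω → ℝ}

/-- The function whose expectation at `X - x` vanishes exactly at the `q`-expectile `x`. -/
def expectileScore (q t : ℝ) : ℝ := q * max t 0 + (1 - q) * min t 0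

section Expectile

theorem expectileScore_mono_level {p q : ℝ} (hpq : p ≤ q) (t : ℝ) :
    expectileScore p t ≤ expectileScore q t := by
  unfold expectileScore
  nlinarith [le_max_right t 0, min_le_right t 0]

theorem expectileScore_nonneg {q : ℝ} (h0 : 0 ≤ q) {t : ℝ} (ht : 0 ≤ t) :
    0 ≤ expectileScore q t := by
  unfold expectileScore
  rw [max_eq_left ht, min_eq_right ht]
  nlinarith

theorem min_mul_sub_le_expectileScore_sub {m q : ℝ} (h0 : m ≤ q) (h1 : m ≤ 1 - q) {s t : ℝ}
    (hst : s ≤ t) : m * (t - s) ≤ expectileScore q t - expectileScore q s := by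
  have h3 : max s 0 ≤ max t 0 := max_le_max hst le_rfl
  have h4 : min s 0 ≤ min t 0 := min_le_min hst le_rfl
  have h5 : t - s = (max t 0 - max s 0) + (min t 0 - min s 0) := by
    linarith [max_add_min t 0, max_add_min s 0]
  unfold expectileScore
  rw [h5]
  nlinarith

theorem abs_expectileScore_sub_le {q : ℝ} (h0 : 0 ≤ q) (h1 : q ≤ 1) (s t : ℝ) :
    |expectileScore q t - expectileScore q s| ≤ |t - s| := by
  wlog hst : s ≤ t generalizing s t
  · rw [abs_sub_comm, abs_sub_comm t s]
    exact this t s (not_le.1 hst).le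
  have h3 : max s 0 ≤ max t 0 := max_le_max hst le_rfl
  have h4 : min s 0 ≤ min t 0 := min_le_min hst le_rfl
  have h5 : t - s = (max t 0 - max s 0) + (min t 0 - min s 0) := by
    linarith [max_add_min t 0, max_add_min s 0]
  have h6 := min_mul_sub_le_expectileScore_sub h0 (sub_nonneg.2 h1) hst
  rw [abs_of_nonneg (by linarith), abs_of_nonneg (sub_nonneg.2 hst), h5]
  unfold expectileScore
  nlinarith

theorem integrable_expectileScore [IsFiniteMeasure P] (q : ℝ) (hi : Integrable X P) (x : ℝ) :
    Integrable (fun ω => expectileScore q (X ω - x)) P := by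
  have h : Integrable (fun ω => X ω - x) P := hi.sub (integrable_const x)
  exact (h.pos_part.const_mul q).add ((h.inf (integrable_const 0)).const_mul (1 - q))

/-- The expected score at `x`. -/
noncomputable def expectedScore (P : Measure Ω) (q : ℝ) (X : Ω → ℝ) (x : ℝ) : ℝ :=
  ∫ ω, expectileScore q (X ω - x) ∂P

variable [IsProbabilityMeasure P]

theorem isExpectile_iff (hi : Integrable X P) (q x : ℝ) :
    IsExpectile P q X x ↔ expectedScore P q X x = 0 := by
  have h : Integrable (fun ω => X ω - x) P := hi.sub (integrable_const x)
  have h' : Integrable (fun ω => min (X ω - x) 0) P := h.inf (integrable_const 0)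
  have : expectedScore P q X x =
      q * ∫ ω, max (X ω - x) 0 ∂P - (1 - q) * ∫ ω, -min (X ω - x) 0 ∂P := by
    unfold expectedScore expectileScore
    rw [integral_add (h.pos_part.const_mul q) (h'.const_mul (1 - q)),
      integral_const_mul, integral_const_mul, integral_neg]
    ring
  rw [IsExpectile, this, sub_eq_zero]

theorem mul_sub_le_expectedScore_sub {m q : ℝ} (h0 : m ≤ q) (h1 : m ≤ 1 - q)
    (hi : Integrable X P) {x y : ℝ} (hxy : x ≤ y) :
    m * (y - x) ≤ expectedScore P q X x - expectedScore P q X y := by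
  have ix := integrable_expectileScore q hi x
  have iy := integrable_expectileScore q hi y
  rw [expectedScore, expectedScore, ← integral_sub ix iy]
  calc m * (y - x) = ∫ _, m * (y - x) ∂P := by simp
    _ ≤ _ := integral_mono (integrable_const _) (ix.sub iy) fun ω => by
        have := min_mul_sub_le_expectileScore_sub h0 h1 (sub_le_sub_left hxy (X ω))
        simpa using this

theorem strictAnti_expectedScore {q : ℝ} (h0 : 0 < q) (h1 : q < 1) (hi : Integrable X P) :
    StrictAnti (expectedScore P q X) := fun x y hxy => by
  have h := mul_sub_le_expectedScore_sub (min_le_left q (1 - q)) (min_le_right q (1 - q)) hi hxy.le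
  have : 0 < min q (1 - q) * (y - x) := mul_pos (lt_min h0 (sub_pos.2 h1)) (sub_pos.2 hxy)
  linarith

theorem abs_expectedScore_sub_le {q : ℝ} (h0 : 0 ≤ q) (h1 : q ≤ 1) (hiX : Integrable X P)
    (hiY : Integrable Y P) (x y : ℝ) :
    |expectedScore P q X x - expectedScore P q Y y| ≤ ∫ ω, |(X ω - x) - (Y ω - y)| ∂P := by
  have ix := integrable_expectileScore q hiX x
  have iy := integrable_expectileScore q hiY y
  rw [expectedScore, expectedScore, ← integral_sub ix iy]
  refine abs_integral_le_integral_abs.trans (integral_mono (ix.sub iy).abs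
    ((hiX.sub (integrable_const x)).sub (hiY.sub (integrable_const y))).abs fun ω => ?_)
  exact abs_expectileScore_sub_le h0 h1 _ _

theorem continuous_expectedScore {q : ℝ} (h0 : 0 ≤ q) (h1 : q ≤ 1) (hi : Integrable X P) :
    Continuous (expectedScore P q X) := by
  refine (LipschitzWith.of_dist_le_mul (K := 1) fun x y => ?_).continuous
  have := abs_expectedScore_sub_le h0 h1 hi hi x y
  simpa [Real.dist_eq, abs_sub_comm] using this

theorem exists_expectedScore_eq_zero {q : ℝ} (h0 : 0 < q) (h1 : q < 1) (hi : Integrable X P) :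
    ∃ x, expectedScore P q X x = 0 := by
  set m := min q (1 - q) with hm
  have hm0 : 0 < m := lt_min h0 (sub_pos.2 h1)
  set c := |expectedScore P q X 0| / m
  have hc : 0 ≤ c := by positivity
  have hmc : m * c = |expectedScore P q X 0| := mul_div_cancel₀ _ hm0.ne'
  have hu := mul_sub_le_expectedScore_sub (P := P) (min_le_left q (1 - q))
    (min_le_right q (1 - q)) hi hc
  have hl := mul_sub_le_expectedScore_sub (P := P) (min_le_left q (1 - q))
    (min_le_right q (1 - q)) hi (neg_nonpos.2 hc)
  rw [← hm] at hu hl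
  have h := abs_le.1 (le_refl |expectedScore P q X 0|)
  obtain ⟨x, -, hx⟩ := intermediate_value_Icc' (by linarith : -c ≤ c)
    (continuous_expectedScore h0.le h1.le hi).continuousOn
    (show (0 : ℝ) ∈ Set.Icc (expectedScore P q X c) (expectedScore P q X (-c)) from
      ⟨by linarith, by linarith⟩)
  exact ⟨x, hx⟩

/-- For integrable `X`, the expectile at `q ∈ (0,1)` is a real zero of the expected score. -/
theorem exists_expectile_eq {q : ℝ} (h0 : 0 < q) (h1 : q < 1) (hi : Integrable X P) :
    ∃ x : ℝ, expectile P q X = (x : EReal) ∧ expectedScore P q X x = 0 := by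
  have h : ∃! x : ℝ, IsExpectile P q X x := by
    obtain ⟨x, hx⟩ := exists_expectedScore_eq_zero h0 h1 hi
    refine ⟨x, (isExpectile_iff hi q x).2 hx, fun y hy => ?_⟩
    exact (strictAnti_expectedScore h0 h1 hi).injective (((isExpectile_iff hi q y).1 hy).trans
      hx.symm)
  refine ⟨h.exists.choose, ?_, (isExpectile_iff hi q _).1 h.exists.choose_spec⟩
  rw [expectile, if_neg h0.ne', if_neg h1.ne, dif_pos h]

theorem expectile_mono {p q : ℝ} (hp : 0 ≤ p) (hpq : p ≤ q) (h0 : 0 < q) (h1 : q < 1)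
    (hi : Integrable X P) : expectile P p X ≤ expectile P q X := by
  obtain ⟨y, hy, hy0⟩ := exists_expectile_eq h0 h1 hi
  have hanti := strictAnti_expectedScore (P := P) h0 h1 hi
  rw [hy]
  rcases hp.eq_or_lt with rfl | hp
  · rw [expectile, if_pos rfl]
    by_contra! h
    obtain ⟨c, hyc, hc⟩ := EReal.lt_iff_exists_real_btwn.1 h
    have hae := ae_lt_of_lt_essInf hc
    have : 0 ≤ expectedScore P q X c := integral_nonneg_of_ae <| by
      filter_upwards [hae] with ω hω
      exact expectileScore_nonneg h0.le (sub_nonneg.2 (EReal.coe_lt_coe_iff.1 hω).le)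
    have := hanti (EReal.coe_lt_coe_iff.1 hyc)
    linarith
  · obtain ⟨x, hx, hx0⟩ := exists_expectile_eq hp (hpq.trans_lt h1) hi
    rw [hx, EReal.coe_le_coe_iff]
    by_contra! h
    have h2 : expectedScore P p X x ≤ expectedScore P q X x :=
      integral_mono (integrable_expectileScore p hi x) (integrable_expectileScore q hi x)
        fun ω => expectileScore_mono_level hpq _
    have := hanti h
    linarith

theorem abs_sub_le_of_expectedScore_eq_zero {m q : ℝ} (hm : 0 < m) (h0 : m ≤ q) (h1 : m ≤ 1 - q)
    (hiX : Integrable X P) (hiY : Integrable Y P) {x y : ℝ} (hx : expectedScore P q X x = 0)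
    (hy : expectedScore P q Y y = 0) : |x - y| ≤ 1 / m * ∫ ω, |X ω - Y ω| ∂P := by
  wlog hxy : x ≤ y generalizing x y X Y
  · have := this hiY hiX hy hx (not_le.1 hxy).le
    simpa only [abs_sub_comm] using this
  have h2 := mul_sub_le_expectedScore_sub h0 h1 hiY hxy
  have h3 := abs_expectedScore_sub_le (by linarith) (by linarith : q ≤ 1) hiX hiY x x
  rw [hx, zero_sub, abs_neg] at h3
  have h4 : ∫ ω, |(X ω - x) - (Y ω - x)| ∂P = ∫ ω, |X ω - Y ω| ∂P := by simp
  rw [abs_sub_comm, abs_of_nonneg (sub_nonneg.2 hxy), one_div, le_inv_mul_iff₀ hm]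
  linarith [le_abs_self (expectedScore P q Y x)]

end Expectile

end AdjRisk

namespace AdjRisk

variable {Ω : Type*} [MeasurableSpace Ω] {P : Measure Ω} {g : unitInterval → EReal}

theorem IsTargetProfileZero.nonneg (hg : IsTargetProfileZero g) (p : unitInterval) : 0 ≤ g p :=
  hg.zero ▸ hg.monotone (unitInterval.nonneg p)

section Adjusted

theorem sub_eq_bot_of_not_lt_top {x y : EReal} (hy : ¬ y < ⊤) : x - y = ⊥ := by
  rw [not_lt_top_iff.1 hy, EReal.sub_top]

theorem adjusted_finite {ρ : ℝ → (Ω → ℝ) → EReal} {X : Lp ℝ 1 P} (hg : ∀ p, 0 ≤ g p)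
    {a : unitInterval} (ha : g a = 0) (hbot : ρ a X ≠ ⊥) {C : ℝ}
    (hC : ∀ p : unitInterval, g p < ⊤ → ρ p X ≤ C) :
    adjusted P ρ g X ≠ ⊥ ∧ adjusted P ρ g X ≠ ⊤ := by
  constructor
  · have h : ρ a X - g a ≤ adjusted P ρ g X := le_iSup (fun p : unitInterval => ρ p X - g p) a
    rw [ha, sub_zero] at h
    exact ne_bot_of_le_ne_bot hbot h
  · have h : adjusted P ρ g X ≤ C := iSup_le fun p => by
      by_cases hp : g p < ⊤
      · simpa using EReal.sub_le_sub (hC p hp) (hg p)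
      · rw [sub_eq_bot_of_not_lt_top hp]
        exact bot_le
    exact ne_top_of_le_ne_top (EReal.coe_ne_top C) h

/-- A supremum of real functions with a common Lipschitz constant, shifted by nonnegative penalties,
is finite and continuous as soon as it is locally bounded above and some penalty vanishes. -/
theorem iSup_sub_finite_and_continuous {E ι : Type*} [PseudoMetricSpace E] {r : ι → E → ℝ}
    {c : ι → EReal} {K : NNReal} (hc : ∀ i, 0 ≤ c i) {a : ι} (ha : c a = 0)
    (hr : ∀ i x y, r i x ≤ r i y + K * dist x y) (hb : ∀ x, ∃ C, ∀ i, r i x ≤ C) :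
    (∀ x, (⨆ i, ((r i x : EReal) - c i)) ≠ ⊥ ∧ (⨆ i, ((r i x : EReal) - c i)) ≠ ⊤) ∧
      Continuous fun x => ⨆ i, ((r i x : EReal) - c i) := by
  set F : E → EReal := fun x => ⨆ i, ((r i x : EReal) - c i) with hF
  have hfin : ∀ x, F x ≠ ⊥ ∧ F x ≠ ⊤ := by
    intro x
    constructor
    · have h : (r a x : EReal) - c a ≤ F x := le_iSup (fun i => (r i x : EReal) - c i) a
      rw [ha, sub_zero] at h
      exact ne_bot_of_le_ne_bot (EReal.coe_ne_bot _) h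
    · obtain ⟨C, hC⟩ := hb x
      have h : F x ≤ C := iSup_le fun i => by
        simpa using EReal.sub_le_sub (EReal.coe_le_coe_iff.2 (hC i)) (hc i)
      exact ne_top_of_le_ne_top (EReal.coe_ne_top C) h
  have hcoe : ∀ x, ((F x).toReal : EReal) = F x :=
    fun x => EReal.coe_toReal (hfin x).2 (hfin x).1
  refine ⟨hfin, ?_⟩
  have hlip : LipschitzWith K fun x => (F x).toReal := by
    refine LipschitzWith.of_le_add_mul K fun x y => ?_
    rw [← EReal.coe_le_coe_iff, EReal.coe_add, hcoe, hcoe]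
    refine iSup_le fun i => ?_
    calc (r i x : EReal) - c i ≤ ((r i y + K * dist x y : ℝ) : EReal) - c i :=
          EReal.sub_le_sub (EReal.coe_le_coe_iff.2 (hr i x y)) le_rfl
      _ = ((r i y : EReal) - c i) + ((K * dist x y : ℝ) : EReal) := by
          rw [EReal.coe_add, sub_eq_add_neg, sub_eq_add_neg, add_right_comm]
      _ ≤ _ := by gcongr; exact le_iSup (fun i => (r i y : EReal) - c i) i
  have : F = fun x => ((F x).toReal : EReal) := funext fun x => (hcoe x).symm
  rw [this]
  exact continuous_coe_real_ereal.comp hlip.continuous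

theorem adjusted_finiteValued_and_continuous {ρ : ℝ → (Ω → ℝ) → EReal}
    {r : unitInterval → Lp ℝ 1 P → ℝ} {K : NNReal} (hg : ∀ p, 0 ≤ g p) {a : unitInterval}
    (ha : g a = 0) (hr : ∀ p X Y, r p X ≤ r p Y + K * dist X Y) (hb : ∀ X, ∃ C, ∀ p, r p X ≤ C)
    (hρ : ∀ X, adjusted P ρ g X = ⨆ p, ((r p X : EReal) - g p)) :
    FiniteValued (adjusted P ρ g) ∧ Continuous (adjusted P ρ g) := by
  rw [show adjusted P ρ g = fun X => ⨆ p, ((r p X : EReal) - g p) from funext hρ]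
  exact iSup_sub_finite_and_continuous hg ha hr hb

end Adjusted

section Levels

variable {n : ℕ} {l : ℕ → ℝ}

theorem IsLevels.mono (hl : IsLevels n l) {i j : ℕ} (hij : i ≤ j) (hj : j ≤ n + 1) :
    l i ≤ l j := by
  induction j, hij using Nat.le_induction with
  | base => exact le_rfl
  | succ k _ ih => exact (ih (by omega)).trans (hl.lt_succ k (by omega)).le

theorem IsLevels.lt_one (hl : IsLevels n l) {i : ℕ} (hi : i ≤ n) : l i < 1 :=
  hl.last ▸ (hl.mono hi (by omega)).trans_lt (hl.lt_succ n le_rfl)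

theorem IsLevels.nonneg (hl : IsLevels n l) {i : ℕ} (hi : i ≤ n) : 0 ≤ l i :=
  hl.zero ▸ hl.mono (Nat.zero_le i) (by omega)

theorem IsLevels.lt_of_pos (hl : IsLevels n l) {i : ℕ} (h1 : 1 ≤ i) (hi : i ≤ n) :
    l (i - 1) < l i := by
  have := hl.lt_succ (i - 1) (by omega)
  rwa [Nat.sub_add_cancel h1] at this

theorem IsLevels.pos (hl : IsLevels n l) {i : ℕ} (h1 : 1 ≤ i) (hi : i ≤ n) : 0 < l i :=
  (hl.nonneg (by omega)).trans_lt (hl.lt_of_pos h1 hi)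

/-- A function given piecewise on the cells of the levels takes the value of one of its pieces. -/
theorem IsLevels.piecewise_eq (hl : IsLevels n l) {p : ℝ} (hp0 : 0 ≤ p) (hp1 : p ≤ 1) :
    let S := fun (F : ℕ → ℝ → EReal) (G : ℝ → EReal) => (Set.Icc 0 (l 1)).indicator (F 1) p +
      (∑ i ∈ Finset.Icc 2 n, (Set.Ioc (l (i - 1)) (l i)).indicator (F i) p) +
      (Set.Ioc (l n) 1).indicator G p
    (∃ i, 1 ≤ i ∧ i ≤ n ∧ p ≤ l i ∧ ∀ F G, S F G = F i p) ∨ (l n < p ∧ ∀ F G, S F G = G p) := by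
  intro S
  have hn := hl.one_le
  by_cases h1 : p ≤ l 1
  · refine Or.inl ⟨1, le_rfl, hn, h1, fun F G => ?_⟩
    have hs : ∑ i ∈ Finset.Icc 2 n, (Set.Ioc (l (i - 1)) (l i)).indicator (F i) p = 0 :=
      Finset.sum_eq_zero fun i hi => Set.indicator_of_notMem (fun h => by
        rw [Finset.mem_Icc] at hi
        exact absurd (h1.trans (hl.mono (by omega) (by omega))) h.1.not_ge) _
    have h2 : p ≤ l n := h1.trans (hl.mono hn (by omega))
    have hm : p ∈ Set.Icc 0 (l 1) := ⟨hp0, h1⟩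
    simp only [S]
    rw [hs, Set.indicator_of_mem hm, Set.indicator_of_notMem fun h => h.1.not_ge h2,
      add_zero, add_zero]
  have h1' : p ∉ Set.Icc 0 (l 1) := fun h => h1 h.2
  by_cases h2 : l n < p
  · refine Or.inr ⟨h2, fun F G => ?_⟩
    have hs : ∑ i ∈ Finset.Icc 2 n, (Set.Ioc (l (i - 1)) (l i)).indicator (F i) p = 0 :=
      Finset.sum_eq_zero fun i hi => Set.indicator_of_notMem (fun h => by
        rw [Finset.mem_Icc] at hi
        exact absurd (h.2.trans (hl.mono hi.2 (by omega))) h2.not_ge) _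
    have hm : p ∈ Set.Ioc (l n) 1 := ⟨h2, hp1⟩
    simp only [S]
    rw [hs, Set.indicator_of_notMem h1', Set.indicator_of_mem hm, zero_add, zero_add]
  have h2' : p ∉ Set.Ioc (l n) 1 := fun h => h2 h.1
  classical
  have hex : ∃ i, p ≤ l i := ⟨n, not_lt.1 h2⟩
  set i := Nat.find hex with hi
  have hpi : p ≤ l i := Nat.find_spec hex
  have hin : i ≤ n := Nat.find_min' hex (not_lt.1 h2)
  have hi2 : 2 ≤ i := by
    by_contra! h
    exact h1 (hpi.trans (hl.mono (by omega) (by omega)))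
  have hpi' : l (i - 1) < p := not_le.1 (Nat.find_min hex (by omega))
  refine Or.inl ⟨i, by omega, hin, hpi, fun F G => ?_⟩
  have hm : p ∈ Set.Ioc (l (i - 1)) (l i) := ⟨hpi', hpi⟩
  simp only [S]
  rw [Set.indicator_of_notMem h1', Set.indicator_of_notMem h2', zero_add, add_zero,
    Finset.sum_eq_single i, Set.indicator_of_mem hm]
  · intro j hj hji
    rw [Finset.mem_Icc] at hj
    refine Set.indicator_of_notMem (fun h => ?_) _
    rcases hji.lt_or_gt with hlt | hgt
    · exact absurd (h.2.trans (hl.mono (by omega) (by omega))) hpi'.not_ge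
    · exact absurd (hpi.trans (hl.mono (by omega) (by omega))) h.1.not_ge
  · intro h
    exact absurd (Finset.mem_Icc.2 ⟨hi2, hin⟩) h

theorem familyC_eq (hl : IsLevels n l) {p : ℝ} (hp0 : 0 ≤ p) (hp1 : p ≤ 1) (X : Ω → ℝ) :
    (∃ i, 1 ≤ i ∧ i ≤ n ∧ p ≤ l i ∧ familyC P n l p X = RVaR P p (l i) X) ∨
      (l n < p ∧ familyC P n l p X = ES P p X) := by
  rcases hl.piecewise_eq hp0 hp1 with ⟨i, h1, hin, hpi, h⟩ | ⟨hp, h⟩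
  · exact Or.inl ⟨i, h1, hin, hpi, h (fun i p => RVaR P p (l i) X) fun p => ES P p X⟩
  · exact Or.inr ⟨hp, h (fun i p => RVaR P p (l i) X) fun p => ES P p X⟩

theorem familySC_eq {r p : ℝ} (hp0 : 0 ≤ p) (hp1 : p ≤ 1) (X : Ω → ℝ) :
    familySC P r p X = if p ≤ r then VaR P p X else ES P p X := by
  unfold familySC
  split_ifs with h
  · have hm : p ∈ Set.Icc 0 r := ⟨hp0, h⟩
    rw [Set.indicator_of_mem hm, Set.indicator_of_notMem fun h' => h'.1.not_ge h, add_zero]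
  · have hm : p ∈ Set.Ioc r 1 := ⟨not_le.1 h, hp1⟩
    rw [Set.indicator_of_notMem fun h' => h h'.2, Set.indicator_of_mem hm, zero_add]

variable [IsProbabilityMeasure P]

theorem exists_familyFC_eq (hl : IsLevels n l) {b : ℝ} (hb : b < 1) :
    ∃ K : NNReal, ∀ p : ℝ, 0 ≤ p → p ≤ b → ∃ c α β : ℝ, 0 ≤ c ∧ c ≤ K ∧ 0 ≤ α ∧ β ≤ 1 ∧
      ∀ X : Ω → ℝ, Measurable X → Integrable X P →
        familyFC P n l p X = ((c * quantileIntegral P α β X : ℝ) : EReal) := by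
  have hs : ∀ i ∈ Finset.Icc 1 n, 0 ≤ 1 / (l i - l (i - 1)) := fun i hi => by
    rw [Finset.mem_Icc] at hi
    exact one_div_nonneg.2 (sub_nonneg.2 (hl.lt_of_pos hi.1 hi.2).le)
  have hb' : 0 ≤ 1 / (1 - b) := one_div_nonneg.2 (sub_nonneg.2 hb.le)
  obtain ⟨K, hK⟩ : ∃ K : NNReal,
      (K : ℝ) = ∑ i ∈ Finset.Icc 1 n, 1 / (l i - l (i - 1)) + 1 / (1 - b) :=
    ⟨⟨_, add_nonneg (Finset.sum_nonneg hs) hb'⟩, rfl⟩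
  refine ⟨K, fun p hp0 hpb => ?_⟩
  have hp1 : p < 1 := hpb.trans_lt hb
  have hS : ∀ X : Ω → ℝ, familyFC P n l p X =
      (Set.Icc 0 (l 1)).indicator (fun _ => RVaR P (l (1 - 1)) (l 1) X) p +
      (∑ i ∈ Finset.Icc 2 n, (Set.Ioc (l (i - 1)) (l i)).indicator
        (fun _ => RVaR P (l (i - 1)) (l i) X) p) +
      (Set.Ioc (l n) 1).indicator (fun p => ES P p X) p := fun X => by
    simp only [familyFC, Nat.sub_self, hl.zero]
  rcases hl.piecewise_eq hp0 hp1.le with ⟨i, h1, hin, -, h⟩ | ⟨-, h⟩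
  · refine ⟨1 / (l i - l (i - 1)), l (i - 1), l i, hs i (Finset.mem_Icc.2 ⟨h1, hin⟩), ?_,
      hl.nonneg (by omega), (hl.lt_one hin).le, fun X hX hi => ?_⟩
    · have := Finset.single_le_sum hs (Finset.mem_Icc.2 ⟨h1, hin⟩)
      linarith
    · rw [hS, ← RVaR_eq hX hi (hl.nonneg (by omega)) (hl.lt_of_pos h1 hin) (hl.lt_one hin).le]
      exact h (fun i _ => RVaR P (l (i - 1)) (l i) X) fun p => ES P p X
  · refine ⟨1 / (1 - p), p, 1, one_div_nonneg.2 (sub_nonneg.2 hp1.le), ?_, hp0, le_rfl,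
      fun X hX hi => ?_⟩
    · have h2 : 1 / (1 - p) ≤ 1 / (1 - b) :=
        one_div_le_one_div_of_le (sub_pos.2 hb) (by linarith)
      have := Finset.sum_nonneg hs
      linarith
    · rw [hS, ← ES_eq hX hi hp0 hp1]
      exact h (fun i _ => RVaR P (l (i - 1)) (l i) X) fun p => ES P p X

end Levels

section Finiteness

variable [IsProbabilityMeasure P] {X : Ω → ℝ}

theorem ES_le (hX : Measurable X) (hi : Integrable X P) {p b : ℝ} (hp : 0 ≤ p) (hpb : p ≤ b)
    (hb : b < 1) : ES P p X ≤ ((1 / (1 - b) * ∫ ω, |X ω| ∂P : ℝ) : EReal) := by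
  have hb' : 0 < 1 - b := sub_pos.2 hb
  rw [ES_eq hX hi hp (hpb.trans_lt hb), EReal.coe_le_coe_iff]
  have h1 := (le_abs_self _).trans (abs_quantileIntegral_le hX hi hp (le_refl (1 : ℝ)))
  have h2 : 1 / (1 - p) ≤ 1 / (1 - b) := one_div_le_one_div_of_le hb' (by linarith)
  have h3 : 0 ≤ 1 / (1 - p) := one_div_nonneg.2 (by linarith)
  exact (mul_le_mul_of_nonneg_left h1 h3).trans
    (mul_le_mul_of_nonneg_right h2 (integral_nonneg fun _ => abs_nonneg _))

theorem VaR_le_quantile (hX : Measurable X) {p b : ℝ} (hp : 0 ≤ p) (hpb : p ≤ b) (h0 : 0 < b)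
    (hb : b < 1) : VaR P p X ≤ (quantile P X b : EReal) := by
  rcases hp.eq_or_lt with rfl | hp
  · rw [VaR, if_pos rfl]
    exact essInf_le_quantile hX h0 hb
  · rw [VaR_eq_quantile hX hp (hpb.trans_lt hb), EReal.coe_le_coe_iff]
    exact quantile_mono_level hX hp hb hpb

theorem RVaR_le_quantile (hX : Measurable X) (hi : Integrable X P) {p b : ℝ} (hp : 0 ≤ p)
    (hpb : p ≤ b) (h0 : 0 < b) (hb : b < 1) : RVaR P p b X ≤ (quantile P X b : EReal) := by
  rcases hpb.eq_or_lt with rfl | h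
  · rw [RVaR, if_neg (lt_irrefl _)]
    exact VaR_le_quantile hX hp le_rfl h0 hb
  · have hpos : 0 < b - p := sub_pos.2 h
    rw [RVaR_eq hX hi hp h hb.le, EReal.coe_le_coe_iff, one_div, inv_mul_le_iff₀ hpos]
    exact quantileIntegral_le hX hi hp hpb hb

theorem RVaR_ne_bot (hX : Measurable X) (hi : Integrable X P) {p b : ℝ} (hp : 0 < p)
    (hpb : p ≤ b) (hb : b < 1) : RVaR P p b X ≠ ⊥ := by
  rcases hpb.eq_or_lt with rfl | h
  · rw [RVaR, if_neg (lt_irrefl _), VaR_eq_quantile hX hp hb]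
    exact EReal.coe_ne_bot _
  · rw [RVaR_eq hX hi hp.le h hb.le]
    exact EReal.coe_ne_bot _

variable {a b : unitInterval}

theorem SCRM_finiteValued (hg : IsTargetProfileZero g) (ha : g a = 0) (ha0 : 0 < a) (ha1 : a < 1)
    (hb : ∀ p, g p < ⊤ → p ≤ b) (hb0 : 0 < b) (hb1 : b < 1) (r : ℝ) :
    FiniteValued (SCRM P r g) := by
  intro X
  have hX := (Lp.stronglyMeasurable X).measurable
  have hi := L1.integrable_coeFn X
  refine adjusted_finite hg.nonneg ha ?_
    (C := max (quantile P X b) (1 / (1 - (b : ℝ)) * ∫ ω, |X ω| ∂P)) fun p hp => ?_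
  · rw [familySC_eq a.2.1 a.2.2]
    split_ifs
    · rw [VaR_eq_quantile hX ha0 ha1]
      exact EReal.coe_ne_bot _
    · rw [ES_eq hX hi a.2.1 ha1]
      exact EReal.coe_ne_bot _
  · rw [familySC_eq p.2.1 p.2.2]
    split_ifs
    · exact (VaR_le_quantile hX p.2.1 (hb p hp) hb0 hb1).trans
        (EReal.coe_le_coe_iff.2 (le_max_left _ _))
    · exact (ES_le hX hi p.2.1 (hb p hp) hb1).trans (EReal.coe_le_coe_iff.2 (le_max_right _ _))

theorem CRM_finiteValued (hg : IsTargetProfileZero g) (ha : g a = 0) (ha0 : 0 < a) (ha1 : a < 1)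
    (hb : ∀ p, g p < ⊤ → p ≤ b) (hb1 : b < 1) {n : ℕ} {l : ℕ → ℝ} (hl : IsLevels n l) :
    FiniteValued (CRM P n l g) := by
  intro X
  have hX := (Lp.stronglyMeasurable X).measurable
  have hi := L1.integrable_coeFn X
  refine adjusted_finite hg.nonneg ha ?_
    (C := max (quantile P X (l n)) (1 / (1 - (b : ℝ)) * ∫ ω, |X ω| ∂P)) fun p hp => ?_
  · rcases familyC_eq (P := P) hl a.2.1 a.2.2 X with ⟨i, -, hin, hai, h⟩ | ⟨-, h⟩
    · rw [h]
      exact RVaR_ne_bot hX hi ha0 hai (hl.lt_one hin)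
    · rw [h, ES_eq hX hi a.2.1 ha1]
      exact EReal.coe_ne_bot _
  · rcases familyC_eq (P := P) hl p.2.1 p.2.2 X with ⟨i, h1, hin, hpi, h⟩ | ⟨-, h⟩
    · rw [h]
      refine (RVaR_le_quantile hX hi p.2.1 hpi (hl.pos h1 hin) (hl.lt_one hin)).trans
        (EReal.coe_le_coe_iff.2 (le_max_of_le_left ?_))
      exact quantile_mono_level hX (hl.pos h1 hin) (hl.lt_one le_rfl) (hl.mono hin (by omega))
    · rw [h]
      exact (ES_le hX hi p.2.1 (hb p hp) hb1).trans (EReal.coe_le_coe_iff.2 (le_max_right _ _))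

theorem FCRM_finiteValued_and_continuous (hg : IsTargetProfileZero g) (ha : g a = 0)
    (hb : ∀ p, g p < ⊤ → p ≤ b) (hb1 : b < 1) {n : ℕ} {l : ℕ → ℝ} (hl : IsLevels n l) :
    FiniteValued (FCRM P n l g) ∧ Continuous (FCRM P n l g) := by
  obtain ⟨K, hK⟩ := exists_familyFC_eq (P := P) hl hb1
  have hK' : ∀ p : unitInterval, ∃ c α β : ℝ, 0 ≤ c ∧ c ≤ K ∧ 0 ≤ α ∧ β ≤ 1 ∧ (g p < ⊤ →
      ∀ X : Ω → ℝ, Measurable X → Integrable X P →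
        familyFC P n l p X = ((c * quantileIntegral P α β X : ℝ) : EReal)) := fun p => by
    by_cases hp : g p < ⊤
    · obtain ⟨c, α, β, h0, h1, h2, h3, h⟩ := hK p p.2.1 (hb p hp)
      exact ⟨c, α, β, h0, h1, h2, h3, fun _ => h⟩
    · exact ⟨0, 0, 0, le_rfl, K.2, le_rfl, zero_le_one, fun h => absurd h hp⟩
  choose c α β hc0 hcK hα hβ h using hK'
  have hm := fun X : Lp ℝ 1 P => (Lp.stronglyMeasurable X).measurable
  have hi := fun X : Lp ℝ 1 P => L1.integrable_coeFn X
  refine adjusted_finiteValued_and_continuous hg.nonneg ha (K := K)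
    (r := fun p X => c p * quantileIntegral P (α p) (β p) X) (fun p X Y => ?_) (fun X => ?_)
    fun X => ?_
  · have h1 := (le_abs_self _).trans
      (abs_quantileIntegral_sub_le (hm X) (hm Y) (hi X) (hi Y) (hα p) (hβ p))
    have h2 : dist X Y = ∫ ω, |X ω - Y ω| ∂P := L1.dist_eq_integral_dist X Y
    rw [← h2] at h1
    have h3 := mul_le_mul_of_nonneg_left h1 (hc0 p)
    have h4 := mul_le_mul_of_nonneg_right (hcK p) (dist_nonneg (x := X) (y := Y))
    linarith
  · refine ⟨K * ∫ ω, |X ω| ∂P, fun p => ?_⟩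
    have h1 := (le_abs_self _).trans (abs_quantileIntegral_le (hm X) (hi X) (hα p) (hβ p))
    exact (mul_le_mul_of_nonneg_left h1 (hc0 p)).trans
      (mul_le_mul_of_nonneg_right (hcK p) (integral_nonneg fun _ => abs_nonneg _))
  · refine iSup_congr fun p => ?_
    by_cases hp : g p < ⊤
    · rw [h p hp X (hm X) (hi X)]
    · rw [sub_eq_bot_of_not_lt_top hp, sub_eq_bot_of_not_lt_top hp]

theorem adjusted_expectile_eq (hg : IsTargetProfileZero g) (ha : g a = 0) (ha0 : 0 < a)
    (hb : ∀ p, g p < ⊤ → p ≤ b) (hab : a ≤ b) (hb1 : b < 1) (X : Lp ℝ 1 P) :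
    adjusted P (expectile P) g X =
      ⨆ p : unitInterval, (expectile P (min (max a p) b : unitInterval) X - g p) := by
  have hi := L1.integrable_coeFn X
  apply le_antisymm
  · refine iSup_le fun p => le_iSup_of_le p ?_
    by_cases hp : g p < ⊤
    · rw [min_eq_left (max_le hab (hb p hp))]
      have h0 : 0 < max a p := lt_max_of_lt_left ha0
      have h1 : max a p < 1 := (max_le hab (hb p hp)).trans_lt hb1
      exact EReal.sub_le_sub (expectile_mono p.2.1 (le_max_right a p) h0 h1 hi) le_rfl
    · rw [sub_eq_bot_of_not_lt_top hp, sub_eq_bot_of_not_lt_top hp]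
  · refine iSup_le fun p => ?_
    by_cases hp : g p < ⊤
    · rw [min_eq_left (max_le hab (hb p hp))]
      rcases le_total p a with hpa | hpa
      · rw [max_eq_left hpa]
        refine le_iSup_of_le a (EReal.sub_le_sub le_rfl ?_)
        rw [ha]
        exact hg.nonneg p
      · rw [max_eq_right hpa]
        exact le_iSup (fun p : unitInterval => expectile P p X - g p) p
    · rw [sub_eq_bot_of_not_lt_top hp]
      exact bot_le

theorem AERM_finiteValued_and_continuous (hg : IsTargetProfileZero g) (ha : g a = 0) (ha0 : 0 < a)
    (hb : ∀ p, g p < ⊤ → p ≤ b) (hab : a ≤ b) (hb1 : b < 1) :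
    FiniteValued (AERM P g) ∧ Continuous (AERM P g) := by
  have hb0 : 0 < b := ha0.trans_le hab
  set q : unitInterval → unitInterval := fun p => min (max a p) b
  have hqa : ∀ p, a ≤ q p := fun p => le_min (le_max_left a p) hab
  have hqb : ∀ p, q p ≤ b := fun p => min_le_right _ _
  have hq0 : ∀ p, 0 < (q p : ℝ) := fun p => ha0.trans_le (hqa p)
  have hq1 : ∀ p, (q p : ℝ) < 1 := fun p => (hqb p).trans_lt hb1
  have hi := fun X : Lp ℝ 1 P => L1.integrable_coeFn X
  choose r hr hr0 using fun p (X : Lp ℝ 1 P) => exists_expectile_eq (hq0 p) (hq1 p) (hi X)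
  set m : ℝ := min a (1 - b)
  have hm : 0 < m := lt_min ha0 (sub_pos.2 hb1)
  obtain ⟨K, hK⟩ : ∃ K : NNReal, (K : ℝ) = 1 / m := ⟨⟨_, one_div_nonneg.2 hm.le⟩, rfl⟩
  have hmq : ∀ p, m ≤ q p := fun p => (min_le_left _ _).trans (hqa p)
  have hmq' : ∀ p, m ≤ 1 - q p := fun p => (min_le_right _ _).trans (sub_le_sub_left (show (q p : ℝ) ≤ b from hqb p) 1)
  refine adjusted_finiteValued_and_continuous hg.nonneg ha
    (K := K) (r := r) (fun p X Y => ?_) (fun X => ?_) fun X => ?_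
  · have h1 := (le_abs_self _).trans (abs_sub_le_of_expectedScore_eq_zero hm (hmq p) (hmq' p)
      (hi X) (hi Y) (hr0 p X) (hr0 p Y))
    have h2 : dist X Y = ∫ ω, |X ω - Y ω| ∂P := L1.dist_eq_integral_dist X Y
    rw [← h2] at h1
    rw [hK]
    linarith
  · obtain ⟨C, hC, -⟩ := exists_expectile_eq hb0 hb1 (hi X)
    refine ⟨C, fun p => ?_⟩
    rw [← EReal.coe_le_coe_iff, ← hr, ← hC]
    exact expectile_mono (hq0 p).le (hqb p) hb0 hb1 (hi X)
  · rw [adjusted_expectile_eq hg ha ha0 hb hab hb1]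
    exact iSup_congr fun p => by rw [← hr]

end Finiteness

end AdjRisk

theorem mainTheorem5 {Ω : Type*} [MeasurableSpace Ω] (P : Measure Ω) [IsProbabilityMeasure P]
    (g : unitInterval → EReal) (hg : AdjRisk.FinitenessAssumption g) :
    (∀ r ∈ Set.Ioo (0 : ℝ) 1, AdjRisk.FiniteValued (AdjRisk.SCRM P r g)) ∧
    (∀ (n : ℕ) (l : ℕ → ℝ), AdjRisk.IsLevels n l → AdjRisk.FiniteValued (AdjRisk.CRM P n l g)) ∧
    (∀ (n : ℕ) (l : ℕ → ℝ), AdjRisk.IsLevels n l →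
      AdjRisk.FiniteValued (AdjRisk.FCRM P n l g) ∧ Continuous (AdjRisk.FCRM P n l g)) ∧
    (AdjRisk.FiniteValued (AdjRisk.AERM P g) ∧ Continuous (AdjRisk.AERM P g)) := by
  obtain ⟨a, b, ha, hb, ha0, hab, hb1⟩ := hg.levels
  have hg0 := hg.toIsTargetProfileZero
  have hb' : ∀ p, g p < ⊤ → p ≤ b := fun p hp => hb.2 hp
  have ha1 : a < 1 := hab.trans hb1
  exact ⟨fun r _ => AdjRisk.SCRM_finiteValued hg0 ha.1 ha0 ha1 hb' (ha0.trans hab) hb1 r,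
    fun n l hl => AdjRisk.CRM_finiteValued hg0 ha.1 ha0 ha1 hb' hb1 hl,
    fun n l hl => AdjRisk.FCRM_finiteValued_and_continuous hg0 ha.1 hb' hb1 hl,
    AdjRisk.AERM_finiteValued_and_continuous hg0 ha.1 ha0 hb' hab.le hb1⟩
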